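/- **Theorem (linearization trick).** Let $\mathcal A,\mathcal B$ be unital $C^*$-algebras with units $1_{\mathcal A},1_{\mathcal B}$, let $r\in\mathbb N$, and let $x_1,\dots,x_r\in\mathcal A$ and $y_1,\dots,y_r\in\mathcal B$ be self-adjoint. Let $\mathcal A_0=C^*(1_{\mathcal A},x_1,\dots,x_r)\subseteq\mathcal A$ and $\mathcal B_0=C^*(1_{\mathcal B},y_1,\dots,y_r)\subseteq\mathcal B$ be the unital $C^*$-subalgebras generated by these elements, and let ${\rm sp}$ denote the spectrum. Suppose that at least one of the following two conditions holds. (i) For all $m\in\mathbb N$ and all self-adjoint matrices $a_0,a_1,\dots,a_r\in M_m(\mathbb C)$, $${\rm sp}\Big(a_0\otimes 1_{\mathcal B}+\sum_{i=1}^r a_i\otimes y_i\Big)\subseteq{\rm sp}\Big(a_0\otimes 1_{\mathcal A}+\sum_{i=1}^r a_i\otimes x_i\Big),$$ the spectra being taken in $M_m(\mathbb C)\otimes\mathcal B$ and $M_m(\mathbb C)\otimes\mathcal A$ respectively. (ii) The same inclusion holds for all $m\in\mathbb N$ and all self-adjoint matrices $a_0,a_1,\dots,a_r\in M_m(\mathbb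 C)$ with entries in $\mathbb Q+{\rm i}\mathbb Q$. Then there is exactly one unital $*$-homomorphism $\varphi\colon\mathcal A_0\to\mathcal B_0$ with $\varphi(x_i)=y_i$ for $i=1,\dots,r$, and it is surjective. Moreover, for every polynomial $p$ in $r$ noncommuting variables with complex coefficients, $$\|p(y_1,\dots,y_r)\|\le\|p(x_1,\dots,x_r)\|.$$ -/

import Mathlib

open scoped TensorProduct

/-- The affine linear pencil `a₀ ⊗ 1 + ∑ aᵢ ⊗ xᵢ` with `m × m` matrix coefficients, as an element
of the algebra `M_m(ℂ) ⊗ A`. For finite `m` the algebraic tensor product is already complete, so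
this is the C⋆-algebra `M_m(ℂ) ⊗ A ≅ M_m(A)`, and the spectrum depends only on the algebra. -/
noncomputable def linearPencil {A : Type*} [CStarAlgebra A] {r m : ℕ}
    (a₀ : Matrix (Fin m) (Fin m) ℂ) (a : Fin r → Matrix (Fin m) (Fin m) ℂ) (x : Fin r → A) :
    Matrix (Fin m) (Fin m) ℂ ⊗[ℂ] A :=
  a₀ ⊗ₜ[ℂ] (1 : A) + ∑ i, a i ⊗ₜ[ℂ] x i

/-- The unital C⋆-subalgebra `C⋆(1, x₁, …, x_r)` of `A`: the norm closure of the unital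
⋆-subalgebra generated by the `xᵢ`. -/
noncomputable def unitalCStar {A : Type*} [CStarAlgebra A] {r : ℕ} (x : Fin r → A) :
    StarSubalgebra ℂ A :=
  (StarAlgebra.adjoin ℂ (Set.range x)).topologicalClosure

theorem mem_unitalCStar {A : Type*} [CStarAlgebra A] {r : ℕ} (x : Fin r → A) (i : Fin r) :
    x i ∈ unitalCStar x :=
  StarSubalgebra.le_topologicalClosure _ (StarAlgebra.subset_adjoin ℂ _ (Set.mem_range_self i))

/-- The generator `xᵢ`, as an element of `C⋆(1, x₁, …, x_r)`. -/
noncomputable def unitalCStarGen {A : Type*} [CStarAlgebra A] {r : ℕ} (x : Fin r → A)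
    (i : Fin r) : unitalCStar x :=
  ⟨x i, mem_unitalCStar x i⟩

/-- All entries of the matrix lie in `ℚ + iℚ`. -/
def HasGaussianRationalEntries {m : ℕ} (a : Matrix (Fin m) (Fin m) ℂ) : Prop :=
  ∀ j k, ∃ p q : ℚ, a j k = (p : ℂ) + (q : ℂ) * Complex.I

/-! Every noncommutative polynomial can be written p = u Q⁻¹ v with scalar vectors u, v and an
affine linear pencil Q invertible over the free algebra. Bordering Q and Q⋆ yields a Hermitian
linear pencil H_t whose Schur complement is t - p⋆p (`isUnit_hermitianPencil_iff`). So t lies in the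
spectrum of p(x)⋆p(x) exactly when 0 lies in that of H_t(x), and inclusion for pencils gives
inclusion for p⋆p. Norms of self-adjoint elements are read off the spectrum, so the C⋆-identity
yields ‖p(y)‖ ≤ ‖p(x)‖.

Rational coefficients suffice because the inclusion survives norm limits when the smaller spectra
belong to normal elements (`spectrum_subset_of_tendsto`).

For the homomorphism, take the C⋆-algebra generated by the pairs (xᵢ, yᵢ) in A × B. The norm bound
makes its first projection injective, and closedness of ranges makes it onto C⋆(1, x). Its inverse
followed by the second projection is φ. -/

open Matrix Filter Topology

/-! ### Affine linear pencils as matrices over an algebra -/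

section Pencil

/-- The affine linear pencil `a₀ + ∑ aᵢ xᵢ`, written as a matrix with entries in `A`. -/
noncomputable def pencilMatrix {A : Type*} [Ring A] [Algebra ℂ A] {ι k l : Type*} [Fintype ι]
    (a₀ : Matrix k l ℂ) (a : ι → Matrix k l ℂ) (x : ι → A) : Matrix k l A :=
  Matrix.of fun s t => algebraMap ℂ A (a₀ s t) + ∑ i, a i s t • x i

variable {A : Type*} [Ring A] [Algebra ℂ A] {ι k l k' l' : Type*} [Fintype ι]

theorem pencilMatrix_apply (a₀ : Matrix k l ℂ) (a : ι → Matrix k l ℂ) (x : ι → A) (s : k) (t : l) :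
    pencilMatrix a₀ a x s t = algebraMap ℂ A (a₀ s t) + ∑ i, a i s t • x i := rfl

@[simp]
theorem pencilMatrix_zero (a₀ : Matrix k l ℂ) (x : ι → A) :
    pencilMatrix a₀ (fun _ => 0) x = a₀.map (algebraMap ℂ A) := by
  ext s t
  simp [pencilMatrix_apply]

theorem pencilMatrix_fromBlocks (a₀ : Matrix k l ℂ) (a : ι → Matrix k l ℂ)
    (b₀ : Matrix k l' ℂ) (b : ι → Matrix k l' ℂ) (c₀ : Matrix k' l ℂ) (c : ι → Matrix k' l ℂ)
    (d₀ : Matrix k' l' ℂ) (d : ι → Matrix k' l' ℂ) (x : ι → A) :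
    pencilMatrix (fromBlocks a₀ b₀ c₀ d₀) (fun i => fromBlocks (a i) (b i) (c i) (d i)) x =
      fromBlocks (pencilMatrix a₀ a x) (pencilMatrix b₀ b x) (pencilMatrix c₀ c x)
        (pencilMatrix d₀ d x) := by
  ext (s | s) (t | t) <;> rfl

theorem pencilMatrix_map {B : Type*} [Ring B] [Algebra ℂ B] (f : A →ₐ[ℂ] B)
    (a₀ : Matrix k l ℂ) (a : ι → Matrix k l ℂ) (x : ι → A) :
    (pencilMatrix a₀ a x).map f = pencilMatrix a₀ a (fun i => f (x i)) := by
  ext s t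
  simp [pencilMatrix_apply]

theorem conjTranspose_pencilMatrix [StarRing A] [StarModule ℂ A]
    (a₀ : Matrix k l ℂ) (a : ι → Matrix k l ℂ) {x : ι → A} (hx : ∀ i, IsSelfAdjoint (x i)) :
    (pencilMatrix a₀ a x)ᴴ = pencilMatrix a₀ᴴ (fun i => (a i)ᴴ) x := by
  ext s t
  simp [pencilMatrix_apply, (hx _).star_eq, ← algebraMap_star_comm]

theorem pencilMatrix_submatrix (e : k' → k) (f : l' → l)
    (a₀ : Matrix k l ℂ) (a : ι → Matrix k l ℂ) (x : ι → A) :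
    (pencilMatrix a₀ a x).submatrix e f =
      pencilMatrix (a₀.submatrix e f) (fun i => (a i).submatrix e f) x := rfl

end Pencil

/-! ### Schur complements over a noncommutative ring -/

section Schur

variable {R : Type*} [Ring R] {k l : Type*} [Fintype k] [DecidableEq k] [Fintype l] [DecidableEq l]

theorem isUnit_fromBlocks_upper_one (B : Matrix k l R) :
    IsUnit (fromBlocks 1 B 0 1 : Matrix (k ⊕ l) (k ⊕ l) R) :=
  isUnit_iff_exists.2 ⟨fromBlocks 1 (-B) 0 1, by simp [fromBlocks_multiply],
    by simp [fromBlocks_multiply]⟩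

theorem isUnit_fromBlocks_lower_one (C : Matrix l k R) :
    IsUnit (fromBlocks 1 0 C 1 : Matrix (k ⊕ l) (k ⊕ l) R) :=
  isUnit_iff_exists.2 ⟨fromBlocks 1 0 (-C) 1, by simp [fromBlocks_multiply],
    by simp [fromBlocks_multiply]⟩

theorem isUnit_fromBlocks_diagonal_iff {S : Matrix k k R} {D E : Matrix l l R}
    (hDE : D * E = 1) (hED : E * D = 1) : IsUnit (fromBlocks S 0 0 D) ↔ IsUnit S := by
  simp only [isUnit_iff_exists]
  constructor
  · rintro ⟨M, h₁, h₂⟩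
    rw [← fromBlocks_toBlocks M, fromBlocks_multiply, ← fromBlocks_one, fromBlocks_inj] at h₁ h₂
    exact ⟨M.toBlocks₁₁, by simpa using h₁.1, by simpa using h₂.1⟩
  · rintro ⟨T, h₁, h₂⟩
    exact ⟨fromBlocks T 0 0 E, by simp [fromBlocks_multiply, *], by simp [fromBlocks_multiply, *]⟩

/-- The Schur complement criterion over a noncommutative ring. -/
theorem isUnit_fromBlocks_iff_schur {S : Matrix k k R} {B : Matrix k l R} {C : Matrix l k R}
    {D E : Matrix l l R} (hDE : D * E = 1) (hED : E * D = 1) :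
    IsUnit (fromBlocks S B C D) ↔ IsUnit (S - B * E * C) := by
  -- Block triangular factorization; the two unipotent outer factors do not affect invertibility.
  have key : fromBlocks S B C D =
      fromBlocks 1 (B * E) 0 1 * fromBlocks (S - B * E * C) 0 0 D * fromBlocks 1 0 (E * C) 1 := by
    simp only [fromBlocks_multiply, Matrix.one_mul, Matrix.zero_mul, Matrix.mul_zero,
      Matrix.mul_one, add_zero, zero_add]
    rw [Matrix.mul_assoc B E D, hED, Matrix.mul_one, ← Matrix.mul_assoc D E C, hDE,
      Matrix.one_mul, ← Matrix.mul_assoc B E C, sub_add_cancel]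
  obtain ⟨U, hU⟩ := isUnit_fromBlocks_upper_one (B * E)
  obtain ⟨L, hL⟩ := isUnit_fromBlocks_lower_one (E * C)
  rw [key, ← hU, ← hL, Units.isUnit_mul_units, Units.isUnit_units_mul,
    isUnit_fromBlocks_diagonal_iff hDE hED]

end Schur

/-! ### Linearization of noncommutative polynomials -/

section Linearization

variable {X : Type*} [Fintype X]

/-- A linear representation `p = u Q⁻¹ v` of a noncommutative polynomial `p`, where `u` and `v` are
scalar and `Q` is an affine linear pencil invertible over the free algebra. -/
structure LinearRepresentation (p : FreeAlgebra ℂ X) where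
  /-- The index type of the pencil. -/
  index : Type
  [fintype : Fintype index]
  [decEq : DecidableEq index]
  /-- The constant coefficient. -/
  const : Matrix index index ℂ
  /-- The linear coefficients. -/
  coeff : X → Matrix index index ℂ
  /-- The row vector. -/
  row : Matrix Unit index ℂ
  /-- The column vector. -/
  col : Matrix index Unit ℂ
  /-- The inverse of the pencil. -/
  inv : Matrix index index (FreeAlgebra ℂ X)
  pencil_mul_inv : pencilMatrix const coeff (FreeAlgebra.ι ℂ) * inv = 1
  inv_mul_pencil : inv * pencilMatrix const coeff (FreeAlgebra.ι ℂ) = 1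
  row_mul_inv_mul_col :
    row.map (algebraMap ℂ (FreeAlgebra ℂ X)) * inv * col.map (algebraMap ℂ (FreeAlgebra ℂ X)) = Matrix.of fun _ _ => p

attribute [instance] LinearRepresentation.fintype LinearRepresentation.decEq

theorem Matrix.map_algebraMap_neg_mul {k l n : Type*} [Fintype l] {A : Type*} [Ring A]
    [Algebra ℂ A] (a : Matrix k l ℂ) (b : Matrix l n ℂ) :
    (-(a * b)).map (algebraMap ℂ A) = -(a.map (algebraMap ℂ A) * b.map (algebraMap ℂ A)) := by
  rw [← Matrix.map_mul]
  ext
  simp only [map_apply, Matrix.neg_apply, map_neg]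

namespace LinearRepresentation

/-- The representation of a scalar. -/
noncomputable def scalar (c : ℂ) : LinearRepresentation (algebraMap ℂ (FreeAlgebra ℂ X) c) where
  index := Unit
  const := 1
  coeff := fun _ => 0
  row := Matrix.of fun _ _ => c
  col := 1
  inv := 1
  pencil_mul_inv := by simp
  inv_mul_pencil := by simp
  row_mul_inv_mul_col := by
    ext
    simp

/-- The representation of a generator. -/
noncomputable def generator [DecidableEq X] (i : X) : LinearRepresentation (FreeAlgebra.ι ℂ i) where
  index := Unit ⊕ Unit
  const := fromBlocks 1 0 0 1
  -- The pencil is [[1, -Xᵢ], [0, 1]], whose inverse has Xᵢ in the corner.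
  coeff := fun j => fromBlocks 0 (Matrix.of fun _ _ => if j = i then -1 else 0) 0 0
  row := fromCols 1 0
  col := fromRows 0 1
  inv := fromBlocks 1 (Matrix.of fun _ _ => FreeAlgebra.ι ℂ i) 0 1
  pencil_mul_inv := by
    have h : pencilMatrix (0 : Matrix Unit Unit ℂ) (fun j => Matrix.of fun _ _ => if j = i then -1 else 0)
        (FreeAlgebra.ι ℂ) = -(Matrix.of fun _ _ => FreeAlgebra.ι ℂ i) := by
      ext
      simp [pencilMatrix_apply]
    rw [pencilMatrix_fromBlocks, h]
    simp [fromBlocks_multiply]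
  inv_mul_pencil := by
    have h : pencilMatrix (0 : Matrix Unit Unit ℂ) (fun j => Matrix.of fun _ _ => if j = i then -1 else 0)
        (FreeAlgebra.ι ℂ) = -(Matrix.of fun _ _ => FreeAlgebra.ι ℂ i) := by
      ext
      simp [pencilMatrix_apply]
    rw [pencilMatrix_fromBlocks, h]
    simp [fromBlocks_multiply]
  row_mul_inv_mul_col := by
    simp [fromCols_map, fromRows_map, fromCols_mul_fromBlocks, fromCols_mul_fromRows]

variable {p q : FreeAlgebra ℂ X}

/-- The representation of a sum. -/
noncomputable def add (P : LinearRepresentation p) (Q : LinearRepresentation q) :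
    LinearRepresentation (p + q) where
  index := P.index ⊕ Q.index
  const := fromBlocks P.const 0 0 Q.const
  coeff := fun i => fromBlocks (P.coeff i) 0 0 (Q.coeff i)
  row := fromCols P.row Q.row
  col := fromRows P.col Q.col
  inv := fromBlocks P.inv 0 0 Q.inv
  pencil_mul_inv := by
    simp [pencilMatrix_fromBlocks, fromBlocks_multiply, P.pencil_mul_inv, Q.pencil_mul_inv]
  inv_mul_pencil := by
    simp [pencilMatrix_fromBlocks, fromBlocks_multiply, P.inv_mul_pencil, Q.inv_mul_pencil]
  row_mul_inv_mul_col := by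
    simp only [fromCols_map, fromRows_map, fromCols_mul_fromBlocks, fromCols_mul_fromRows,
      Matrix.mul_zero, add_zero, zero_add, P.row_mul_inv_mul_col, Q.row_mul_inv_mul_col]
    rfl

/-- The representation of a product. -/
noncomputable def mul (P : LinearRepresentation p) (Q : LinearRepresentation q) :
    LinearRepresentation (p * q) where
  index := P.index ⊕ Q.index
  -- The coupling block is scalar, so the pencil stays affine; it puts P⁻¹ v_P u_Q Q⁻¹ in the corner
  -- of the inverse.
  const := fromBlocks P.const (-(P.col * Q.row)) 0 Q.const
  coeff := fun i => fromBlocks (P.coeff i) 0 0 (Q.coeff i)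
  row := fromCols P.row 0
  col := fromRows 0 Q.col
  inv := fromBlocks P.inv
    (P.inv * (P.col.map (algebraMap ℂ (FreeAlgebra ℂ X)) * Q.row.map (algebraMap ℂ (FreeAlgebra ℂ X))) * Q.inv) 0 Q.inv
  pencil_mul_inv := by
    simp [pencilMatrix_fromBlocks, fromBlocks_multiply, P.pencil_mul_inv, Q.pencil_mul_inv,
      ← Matrix.mul_assoc, Matrix.map_algebraMap_neg_mul]
  inv_mul_pencil := by
    simp [pencilMatrix_fromBlocks, fromBlocks_multiply, P.inv_mul_pencil, Q.inv_mul_pencil,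
      Matrix.mul_assoc, Matrix.map_algebraMap_neg_mul]
  row_mul_inv_mul_col := by
    have h : (Matrix.of fun _ _ => p * q : Matrix Unit Unit (FreeAlgebra ℂ X)) =
        (Matrix.of fun _ _ => p) * (Matrix.of fun _ _ => q) := by
      ext
      simp [Matrix.mul_apply]
    rw [h, ← P.row_mul_inv_mul_col, ← Q.row_mul_inv_mul_col]
    simp [fromCols_map, fromRows_map, fromCols_mul_fromBlocks, fromCols_mul_fromRows,
      Matrix.mul_assoc]

theorem nonempty (p : FreeAlgebra ℂ X) : Nonempty (LinearRepresentation p) := by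
  classical
  induction p using FreeAlgebra.induction with
  | grade0 c => exact ⟨scalar c⟩
  | grade1 i => exact ⟨generator i⟩
  | mul p q hp hq => exact hp.elim fun P => hq.elim fun Q => ⟨P.mul Q⟩
  | add p q hp hq => exact hp.elim fun P => hq.elim fun Q => ⟨P.add Q⟩

variable {A : Type*} [Ring A] [Algebra ℂ A] [StarRing A] [StarModule ℂ A]

/-- The constant coefficient of the Hermitian pencil attached to a linear representation of `p`,
whose Schur complement is `t - p⋆ p`. -/
noncomputable def hermitianConst (P : LinearRepresentation p) (t : ℝ) :
    Matrix (Unit ⊕ (P.index ⊕ P.index)) (Unit ⊕ (P.index ⊕ P.index)) ℂ :=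
  fromBlocks (Matrix.of fun _ _ => (t : ℂ)) (fromCols P.colᴴ 0) (fromRows P.col 0)
    (fromBlocks 0 P.const P.constᴴ (-(P.rowᴴ * P.row)))

/-- The linear coefficients of the Hermitian pencil attached to a linear representation. -/
noncomputable def hermitianCoeff (P : LinearRepresentation p) (i : X) :
    Matrix (Unit ⊕ (P.index ⊕ P.index)) (Unit ⊕ (P.index ⊕ P.index)) ℂ :=
  fromBlocks 0 0 0 (fromBlocks 0 (P.coeff i) (P.coeff i)ᴴ 0)

theorem isHermitian_hermitianConst (P : LinearRepresentation p) (t : ℝ) :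
    (P.hermitianConst t).IsHermitian := by
  have h : (Matrix.of fun _ _ => (t : ℂ) : Matrix Unit Unit ℂ)ᴴ = Matrix.of fun _ _ => (t : ℂ) := by
    ext
    simp
  simp [Matrix.IsHermitian, hermitianConst, fromBlocks_conjTranspose, h,
    conjTranspose_fromCols_eq_fromRows_conjTranspose,
    conjTranspose_fromRows_eq_fromCols_conjTranspose]

theorem isHermitian_hermitianCoeff (P : LinearRepresentation p) (i : X) :
    (P.hermitianCoeff i).IsHermitian := by
  simp [Matrix.IsHermitian, hermitianCoeff, fromBlocks_conjTranspose]

/-- The inverse of Q over the free algebra evaluates to an inverse at x, so the lower block of the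
Hermitian pencil is always invertible and the Schur criterion applies. -/
theorem isUnit_hermitianPencil_iff (P : LinearRepresentation p) (t : ℝ) {x : X → A}
    (hx : ∀ i, IsSelfAdjoint (x i)) :
    IsUnit (pencilMatrix (P.hermitianConst t) P.hermitianCoeff x) ↔
      IsUnit (algebraMap ℂ A t - star (FreeAlgebra.lift ℂ x p) * FreeAlgebra.lift ℂ x p) := by
  set f := FreeAlgebra.lift ℂ x with hf
  set Q := pencilMatrix P.const P.coeff x with hQ
  set W := P.inv.map f
  set u : Matrix Unit P.index A := P.row.map (algebraMap ℂ A)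
  set v : Matrix P.index Unit A := P.col.map (algebraMap ℂ A)
  have hmap : (pencilMatrix P.const P.coeff (FreeAlgebra.ι ℂ)).map f = Q := by
    rw [pencilMatrix_map]
    simp [hQ, hf]
  have hQW : Q * W = 1 := by
    rw [← hmap, ← Matrix.map_mul, P.pencil_mul_inv, Matrix.map_one _ (map_zero f) (map_one f)]
  have hWQ : W * Q = 1 := by
    rw [← hmap, ← Matrix.map_mul, P.inv_mul_pencil, Matrix.map_one _ (map_zero f) (map_one f)]
  have huWv : u * W * v = Matrix.of fun _ _ => f p := by
    have := congr_arg (fun M => M.map f) P.row_mul_inv_mul_col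
    simp only [Matrix.map_mul] at this
    convert this using 2
    · congr 1
      ext
      simp [u]
    · ext
      simp [v]
    · ext
      simp
  have hQW' : Wᴴ * Qᴴ = 1 := by rw [← conjTranspose_mul, hQW, conjTranspose_one]
  have hWQ' : Qᴴ * Wᴴ = 1 := by rw [← conjTranspose_mul, hWQ, conjTranspose_one]
  have hu : uᴴ = P.rowᴴ.map (algebraMap ℂ A) := by
    ext
    simp [u, ← algebraMap_star_comm]
  have hv : vᴴ = P.colᴴ.map (algebraMap ℂ A) := by
    ext
    simp [v, ← algebraMap_star_comm]
  have hpencil : pencilMatrix (P.hermitianConst t) P.hermitianCoeff x =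
      fromBlocks (Matrix.of fun _ _ => algebraMap ℂ A t) (fromCols vᴴ 0) (fromRows v 0)
        (fromBlocks 0 Q Qᴴ (-(uᴴ * u))) := by
    unfold hermitianConst hermitianCoeff
    simp only [pencilMatrix_fromBlocks, pencilMatrix_zero, hQ, conjTranspose_pencilMatrix _ _ hx,
      Matrix.map_algebraMap_neg_mul, hu, hv, fromCols_map, fromRows_map]
    simp only [Matrix.map_zero _ (map_zero (algebraMap ℂ A))]
    congr 1
  -- The border (v⋆, 0) sees only the upper left corner of this inverse, giving v⋆W⋆u⋆uWv = p⋆p.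
  have hDE : fromBlocks 0 Q Qᴴ (-(uᴴ * u)) * fromBlocks (Wᴴ * (uᴴ * u) * W) Wᴴ W 0 = 1 := by
    simp [fromBlocks_multiply, hQW, hWQ', ← Matrix.mul_assoc]
  have hED : fromBlocks (Wᴴ * (uᴴ * u) * W) Wᴴ W 0 * fromBlocks 0 Q Qᴴ (-(uᴴ * u)) = 1 := by
    simp [fromBlocks_multiply, hWQ, hQW', Matrix.mul_assoc]
  have hschur : (Matrix.of fun _ _ => algebraMap ℂ A t) -
      fromCols vᴴ (0 : Matrix Unit P.index A) * fromBlocks (Wᴴ * (uᴴ * u) * W) Wᴴ W 0 *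
        fromRows v (0 : Matrix P.index Unit A) =
      (Matrix.of fun _ _ => algebraMap ℂ A t - star (f p) * f p : Matrix Unit Unit A) := by
    have : vᴴ * (Wᴴ * (uᴴ * u) * W) * v = (u * W * v)ᴴ * (u * W * v) := by
      simp [Matrix.mul_assoc]
    simp only [fromCols_mul_fromBlocks, fromCols_mul_fromRows, Matrix.zero_mul, Matrix.mul_zero,
      add_zero, this, huWv]
    ext
    simp [Matrix.mul_apply]
  rw [hpencil, isUnit_fromBlocks_iff_schur hDE hED, hschur,
    ← MulEquiv.isUnit_map (Matrix.uniqueAlgEquiv (m := Unit) (R := ℂ) (A := A))]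
  simp

end LinearRepresentation

end Linearization

/-! ### Spectral inclusion under norm limits -/

section SpectrumPerturbation

variable {A B : Type*} [CStarAlgebra A] [CStarAlgebra B]

/-- Normality bounds the resolvent of b at z by ε⁻¹ via functional calculus; a Neumann series then
inverts a - z. -/
theorem notMem_spectrum_of_norm_sub_lt {a b : A} [IsStarNormal b] {z : ℂ} {ε : ℝ}
    (hb : ∀ w ∈ spectrum ℂ b, ε ≤ ‖w - z‖) (hab : ‖a - b‖ < ε) : z ∉ spectrum ℂ a := by
  have hε : 0 < ε := (norm_nonneg _).trans_lt hab
  have hne : ∀ w ∈ spectrum ℂ b, w - z ≠ 0 := fun w hw => norm_pos_iff.1 (hε.trans_le (hb w hw))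
  have hcont : ContinuousOn (fun w : ℂ => (w - z)⁻¹) (spectrum ℂ b) :=
    ContinuousOn.inv₀ (by fun_prop) hne
  set c := cfc (fun w : ℂ => (w - z)⁻¹) b with hc
  have hbz : cfc (fun w : ℂ => w - z) b = b - algebraMap ℂ A z := by
    rw [cfc_sub (fun w : ℂ => w) (fun _ => z) b, cfc_id' ℂ b, cfc_const z b]
  have h₁ : (b - algebraMap ℂ A z) * c = 1 := by
    rw [← hbz, hc, ← cfc_mul (fun w : ℂ => w - z) (fun w : ℂ => (w - z)⁻¹) b (by fun_prop) hcont,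
      ← cfc_one ℂ b]
    exact cfc_congr fun w hw => mul_inv_cancel₀ (hne w hw)
  have h₂ : c * (b - algebraMap ℂ A z) = 1 := by
    rw [← hbz, hc, ← cfc_mul (fun w : ℂ => (w - z)⁻¹) (fun w : ℂ => w - z) b hcont (by fun_prop),
      ← cfc_one ℂ b]
    exact cfc_congr fun w hw => inv_mul_cancel₀ (hne w hw)
  have hnorm : ‖c‖ ≤ ε⁻¹ := norm_cfc_le (by positivity) fun w hw => by
    rw [norm_inv]
    exact inv_anti₀ hε (hb w hw)
  have hlt : ‖c * (b - a)‖ < 1 := by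
    calc ‖c * (b - a)‖ ≤ ‖c‖ * ‖b - a‖ := norm_mul_le _ _
      _ ≤ ε⁻¹ * ‖b - a‖ := by gcongr
      _ < ε⁻¹ * ε := by
        rw [norm_sub_rev]
        gcongr
      _ = 1 := inv_mul_cancel₀ hε.ne'
  have hu : IsUnit (b - algebraMap ℂ A z) := isUnit_iff_exists.2 ⟨c, h₁, h₂⟩
  have h : a - algebraMap ℂ A z = (b - algebraMap ℂ A z) * (1 - c * (b - a)) := by
    rw [mul_sub, ← mul_assoc, h₁, mul_one, one_mul]
    abel
  rw [spectrum.notMem_iff, ← IsUnit.neg_iff, neg_sub, h]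
  exact hu.mul (isUnit_one_sub_of_norm_lt_one hlt)

/-- Inclusion of spectra passes to norm limits when the smaller spectra are spectra of normal
elements. -/
theorem spectrum_subset_of_tendsto {a : A} {b : B} {a' : ℕ → A} {b' : ℕ → B}
    (ha : Tendsto a' atTop (𝓝 a)) (hb : Tendsto b' atTop (𝓝 b)) [∀ n, IsStarNormal (b' n)]
    (h : ∀ n, spectrum ℂ (b' n) ⊆ spectrum ℂ (a' n)) : spectrum ℂ b ⊆ spectrum ℂ a := by
  intro z hz
  by_contra hza
  rw [spectrum.notMem_iff] at hza
  -- The joint limit in the point and the index gives one disc around z avoiding the spectra of all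
  -- late `a' n`, hence of the `b' n`.
  have hlim : Tendsto (fun q : ℂ × ℕ => algebraMap ℂ A q.1 - a' q.2) (𝓝 z ×ˢ atTop)
      (𝓝 (algebraMap ℂ A z - a)) :=
    (((continuous_algebraMap ℂ A).tendsto z).comp tendsto_fst).sub (ha.comp tendsto_snd)
  have hunit := hlim.eventually (Units.isOpen.mem_nhds hza)
  obtain ⟨p, hp, q, hq, hpq⟩ := eventually_prod_iff.1 hunit
  obtain ⟨ε, hε, hball⟩ := Metric.eventually_nhds_iff.1 hp
  obtain ⟨n, hqn, hn⟩ := (hq.and (Metric.tendsto_nhds.1 hb ε hε)).exists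
  refine notMem_spectrum_of_norm_sub_lt (a := b) (b := b' n) (ε := ε) (fun w hw => ?_) ?_ hz
  · by_contra! hlt
    exact h n hw (hpq (hball (by rwa [dist_eq_norm])) hqn)
  · rwa [norm_sub_rev, ← dist_eq_norm]

end SpectrumPerturbation

/-! ### Spectra of matrices over a C⋆-algebra -/

section MatrixSpectrum

variable {A B : Type*} [CStarAlgebra A] [CStarAlgebra B]

theorem spectrum_ofMatrix {k : Type*} [Fintype k] [DecidableEq k] (M : Matrix k k A) :
    spectrum ℂ (CStarMatrix.ofMatrix M) = spectrum ℂ M :=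
  AlgEquiv.spectrum_eq
    (AlgEquivClass.toAlgEquiv (CStarMatrix.ofMatrixStarAlgEquiv (n := k) (A := A))) M

theorem spectrum_subset_of_tendsto_matrix {k : Type*} [Fintype k] [DecidableEq k]
    {a : Matrix k k A} {b : Matrix k k B} {a' : ℕ → Matrix k k A} {b' : ℕ → Matrix k k B}
    (ha : Tendsto a' atTop (𝓝 a)) (hb : Tendsto b' atTop (𝓝 b)) (hb' : ∀ n, (b' n).IsHermitian)
    (h : ∀ n, spectrum ℂ (b' n) ⊆ spectrum ℂ (a' n)) : spectrum ℂ b ⊆ spectrum ℂ a := by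
  let := CStarAlgebra.spectralOrder A
  let := CStarAlgebra.spectralOrder B
  have := CStarAlgebra.spectralOrderedRing A
  have := CStarAlgebra.spectralOrderedRing B
  simp only [← spectrum_ofMatrix] at h ⊢
  have : ∀ n, IsStarNormal (CStarMatrix.ofMatrix (b' n)) := fun n =>
    IsSelfAdjoint.isStarNormal (hb' n)
  exact spectrum_subset_of_tendsto (a' := fun n => CStarMatrix.ofMatrix (a' n))
    (b' := fun n => CStarMatrix.ofMatrix (b' n)) ha hb h

theorem spectrum_linearPencil {r m : ℕ} (a₀ : Matrix (Fin m) (Fin m) ℂ)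
    (a : Fin r → Matrix (Fin m) (Fin m) ℂ) (x : Fin r → A) :
    spectrum ℂ (linearPencil a₀ a x) = spectrum ℂ (pencilMatrix a₀ a x) := by
  let e : Matrix (Fin m) (Fin m) ℂ ⊗[ℂ] A ≃ₐ[ℂ] Matrix (Fin m) (Fin m) A :=
    (Algebra.TensorProduct.comm ℂ _ _).trans (matrixEquivTensor (Fin m) ℂ A).symm
  have h : e (linearPencil a₀ a x) = pencilMatrix a₀ a x := by
    ext s t
    simp [e, linearPencil, pencilMatrix_apply, Matrix.sum_apply, matrixEquivTensor_apply_symm,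
      Algebra.smul_def, Algebra.commutes]
  rw [← h, AlgEquiv.spectrum_eq]

theorem spectrum_pencilMatrix_reindex {ι k l : Type*} [Fintype ι] [Fintype k] [DecidableEq k]
    [Fintype l] [DecidableEq l] (e : k ≃ l) (a₀ : Matrix k k ℂ) (a : ι → Matrix k k ℂ)
    (x : ι → A) :
    spectrum ℂ (pencilMatrix (a₀.submatrix e.symm e.symm)
      (fun i => (a i).submatrix e.symm e.symm) x) = spectrum ℂ (pencilMatrix a₀ a x) := by
  rw [← pencilMatrix_submatrix]
  exact AlgEquiv.spectrum_eq (Matrix.reindexAlgEquiv ℂ A e) (pencilMatrix a₀ a x)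

end MatrixSpectrum

/-! ### Gaussian rational approximation -/

section GaussianRational

theorem exists_tendsto_gaussianRational :
    ∃ g : ℕ → ℂ → ℂ, (∀ n z, ∃ p q : ℚ, g n z = p + q * Complex.I) ∧
      ∀ z, Tendsto (fun n => g n z) atTop (𝓝 z) := by
  have hex : ∀ t : ℝ, ∃ u : ℕ → ℚ, Tendsto (fun n => (u n : ℝ)) atTop (𝓝 t) := fun t => by
    obtain ⟨u, -, -, hu⟩ := Real.exists_seq_rat_strictMono_tendsto t
    exact ⟨u, hu⟩
  choose u hu using hex
  refine ⟨fun n z => u z.re n + u z.im n * Complex.I, fun n z => ⟨_, _, rfl⟩, fun z => ?_⟩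
  have h := ((Complex.continuous_ofReal.tendsto _).comp (hu z.re)).add
    (((Complex.continuous_ofReal.tendsto _).comp (hu z.im)).mul_const Complex.I)
  simpa [Complex.re_add_im] using h

theorem exists_tendsto_isHermitian_gaussianRational (m : ℕ) :
    ∃ g : ℕ → Matrix (Fin m) (Fin m) ℂ → Matrix (Fin m) (Fin m) ℂ,
      (∀ n a, (g n a).IsHermitian ∧ HasGaussianRationalEntries (g n a)) ∧
        ∀ a, a.IsHermitian → Tendsto (fun n => g n a) atTop (𝓝 a) := by
  obtain ⟨g, hg, hlim⟩ := exists_tendsto_gaussianRational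
  -- Averaging with the adjoint restores Hermitian symmetry and keeps the entries in ℚ + iℚ.
  refine ⟨fun n a => (1 / 2 : ℂ) • (a.map (g n) + (a.map (g n))ᴴ), fun n a => ⟨?_, fun j k => ?_⟩,
    fun a ha => ?_⟩
  · simp [Matrix.IsHermitian, conjTranspose_smul, add_comm]
  · obtain ⟨p, q, h⟩ := hg n (a j k)
    obtain ⟨p', q', h'⟩ := hg n (a k j)
    refine ⟨(p + p') / 2, (q - q') / 2, ?_⟩
    simp [h, h']
    ring
  · have h : Tendsto (fun n => a.map (g n)) atTop (𝓝 a) :=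
      tendsto_pi_nhds.2 fun j => tendsto_pi_nhds.2 fun k => hlim (a j k)
    have h' := (h.add ((continuous_id.matrix_conjTranspose.tendsto a).comp h)).const_smul (1 / 2 : ℂ)
    simp only [id, ha.eq, ← two_smul ℂ a, smul_smul] at h'
    simpa using h'

theorem tendsto_pencilMatrix {A : Type*} [CStarAlgebra A] {ι k : Type*} [Fintype ι]
    {a₀ : Matrix k k ℂ} {a : ι → Matrix k k ℂ} {b₀ : ℕ → Matrix k k ℂ}
    {b : ℕ → ι → Matrix k k ℂ} (h₀ : Tendsto b₀ atTop (𝓝 a₀))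
    (h : ∀ i, Tendsto (fun n => b n i) atTop (𝓝 (a i))) (x : ι → A) :
    Tendsto (fun n => pencilMatrix (b₀ n) (b n) x) atTop (𝓝 (pencilMatrix a₀ a x)) := by
  refine tendsto_pi_nhds.2 fun s => tendsto_pi_nhds.2 fun t => ?_
  exact (((continuous_algebraMap ℂ A).tendsto _).comp
    (tendsto_pi_nhds.1 (tendsto_pi_nhds.1 h₀ s) t)).add
    (tendsto_finsetSum _ fun i _ => (tendsto_pi_nhds.1 (tendsto_pi_nhds.1 (h i) s) t).smul_const (x i))

end GaussianRational

/-! ### From pencils to norms of polynomials -/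

section SpectralInclusion

variable {A B : Type*} [CStarAlgebra A] [CStarAlgebra B] {r : ℕ} {x : Fin r → A} {y : Fin r → B}

/-- Spectral inclusion for Hermitian pencils follows from that for pencils with Gaussian rational
coefficients. -/
theorem spectrum_pencil_subset_of_gaussianRational (hy : ∀ i, IsSelfAdjoint (y i))
    (h : ∀ (m : ℕ) (a₀ : Matrix (Fin m) (Fin m) ℂ) (a : Fin r → Matrix (Fin m) (Fin m) ℂ),
      a₀.IsHermitian → (∀ i, (a i).IsHermitian) →
      HasGaussianRationalEntries a₀ → (∀ i, HasGaussianRationalEntries (a i)) →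
      spectrum ℂ (linearPencil a₀ a y) ⊆ spectrum ℂ (linearPencil a₀ a x))
    (m : ℕ) (a₀ : Matrix (Fin m) (Fin m) ℂ) (a : Fin r → Matrix (Fin m) (Fin m) ℂ)
    (ha₀ : a₀.IsHermitian) (ha : ∀ i, (a i).IsHermitian) :
    spectrum ℂ (linearPencil a₀ a y) ⊆ spectrum ℂ (linearPencil a₀ a x) := by
  obtain ⟨g, hg, hlim⟩ := exists_tendsto_isHermitian_gaussianRational m
  simp only [spectrum_linearPencil] at h ⊢
  refine spectrum_subset_of_tendsto_matrix
    (a' := fun n => pencilMatrix (g n a₀) (fun i => g n (a i)) x)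
    (b' := fun n => pencilMatrix (g n a₀) (fun i => g n (a i)) y)
    (tendsto_pencilMatrix (hlim _ ha₀) (fun i => hlim _ (ha i)) x)
    (tendsto_pencilMatrix (hlim _ ha₀) (fun i => hlim _ (ha i)) y) (fun n => ?_)
    fun n => h m _ _ (hg n _).1 (fun i => (hg n _).1) (hg n _).2 fun i => (hg n _).2
  rw [Matrix.IsHermitian, conjTranspose_pencilMatrix _ _ hy, (hg n _).1.eq]
  simp only [(hg n _).1.eq]

theorem spectrum_star_mul_self_subset (hx : ∀ i, IsSelfAdjoint (x i))
    (hy : ∀ i, IsSelfAdjoint (y i))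
    (h : ∀ (m : ℕ) (a₀ : Matrix (Fin m) (Fin m) ℂ) (a : Fin r → Matrix (Fin m) (Fin m) ℂ),
      a₀.IsHermitian → (∀ i, (a i).IsHermitian) →
      spectrum ℂ (linearPencil a₀ a y) ⊆ spectrum ℂ (linearPencil a₀ a x))
    (p : FreeAlgebra ℂ (Fin r)) :
    spectrum ℝ (star (FreeAlgebra.lift ℂ y p) * FreeAlgebra.lift ℂ y p) ⊆
      spectrum ℝ (star (FreeAlgebra.lift ℂ x p) * FreeAlgebra.lift ℂ x p) := by
  obtain ⟨P⟩ := LinearRepresentation.nonempty p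
  intro t
  contrapose!
  simp only [spectrum.notMem_iff, IsScalarTower.algebraMap_apply ℝ ℂ A,
    IsScalarTower.algebraMap_apply ℝ ℂ B, Complex.coe_algebraMap]
  rw [← P.isUnit_hermitianPencil_iff t hx, ← P.isUnit_hermitianPencil_iff t hy,
    ← spectrum.zero_notMem_iff ℂ, ← spectrum.zero_notMem_iff ℂ]
  -- The hypothesis is needed only at the spectral point 0, after indexing the pencil by `Fin`.
  refine mt fun h0 => ?_
  let e := Fintype.equivFin (Unit ⊕ (P.index ⊕ P.index))
  rw [← spectrum_pencilMatrix_reindex e, ← spectrum_linearPencil] at h0 ⊢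
  exact h _ _ _ (P.isHermitian_hermitianConst t |>.submatrix _)
    (fun i => P.isHermitian_hermitianCoeff i |>.submatrix _) h0

/-- A self-adjoint b has ‖b‖ or -‖b‖ in its spectrum, while spectral values of any a are bounded by
‖a‖. -/
theorem norm_le_norm_of_spectrum_subset {a : A} {b : B} (hb : IsSelfAdjoint b)
    (h : spectrum ℝ b ⊆ spectrum ℝ a) : ‖b‖ ≤ ‖a‖ := by
  nontriviality B
  have key : ∃ t ∈ spectrum ℝ b, ‖t‖ = ‖b‖ := by
    rcases CStarAlgebra.norm_or_neg_norm_mem_spectrum hb with hb | hb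
    · exact ⟨_, hb, by simp⟩
    · exact ⟨_, hb, by simp⟩
  obtain ⟨t, ht, htb⟩ := key
  have hta := h ht
  have : Nontrivial A := by
    by_contra hA
    rw [not_nontrivial_iff_subsingleton] at hA
    simp [spectrum.of_subsingleton] at hta
  rw [← htb]
  exact spectrum.norm_le_norm_of_mem hta

theorem norm_lift_le_of_spectrum_subset (hx : ∀ i, IsSelfAdjoint (x i))
    (hy : ∀ i, IsSelfAdjoint (y i))
    (h : ∀ (m : ℕ) (a₀ : Matrix (Fin m) (Fin m) ℂ) (a : Fin r → Matrix (Fin m) (Fin m) ℂ),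
      a₀.IsHermitian → (∀ i, (a i).IsHermitian) →
      spectrum ℂ (linearPencil a₀ a y) ⊆ spectrum ℂ (linearPencil a₀ a x))
    (p : FreeAlgebra ℂ (Fin r)) :
    ‖FreeAlgebra.lift ℂ y p‖ ≤ ‖FreeAlgebra.lift ℂ x p‖ := by
  have := norm_le_norm_of_spectrum_subset (IsSelfAdjoint.star_mul_self _)
    (spectrum_star_mul_self_subset hx hy h p)
  rw [CStarRing.norm_star_mul_self, CStarRing.norm_star_mul_self] at this
  exact (mul_self_le_mul_self_iff (norm_nonneg _) (norm_nonneg _)).2 this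

end SpectralInclusion

/-! ### Closed range of ⋆-homomorphisms -/

section ClosedRange

variable {A B : Type*} [CStarAlgebra A] [CStarAlgebra B]

theorem StarAlgHom.continuous_of_cstarAlgebra (φ : A →⋆ₐ[ℂ] B) : Continuous φ :=
  AddMonoidHomClass.continuous_of_bound φ 1 fun a => by
    simpa using NonUnitalStarAlgHom.norm_apply_le φ a

theorem StarAlgHom.exists_norm_le_of_isSelfAdjoint (φ : A →⋆ₐ[ℂ] B) {a : A}
    (ha : IsSelfAdjoint a) : ∃ c, φ c = φ a ∧ ‖c‖ ≤ ‖φ a‖ := by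
  cases subsingleton_or_nontrivial B
  · exact ⟨0, Subsingleton.elim _ _, by simp⟩
  set M := ‖φ a‖
  have hM : 0 ≤ M := norm_nonneg _
  -- Truncation to [-M, M] is the identity on the spectrum of φ(a), so it shrinks the lift without
  -- changing its image.
  let g : ℝ → ℝ := fun t => max (-M) (min t M)
  have hg : Continuous g := by fun_prop
  have hφ := φ.continuous_of_cstarAlgebra
  refine ⟨cfc g a, ?_, norm_cfc_le hM fun t _ => ?_⟩
  · have hφa : IsSelfAdjoint (φ a) := ha.map φ
    have h : φ (cfc g a) = cfc g (φ a) := StarAlgHomClass.map_cfc φ g a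
    rw [h]
    conv_rhs => rw [← cfc_id' ℝ (φ a)]
    refine cfc_congr fun t ht => ?_
    have := abs_le.1 (spectrum.norm_le_norm_of_mem ht)
    change max (-M) (min t M) = t
    rw [min_eq_left this.2, max_eq_right this.1]
  · rw [Real.norm_eq_abs, abs_le]
    exact ⟨le_max_left _ _, max_le (by linarith) (min_le_right _ _)⟩

theorem StarAlgHom.exists_norm_le (φ : A →⋆ₐ[ℂ] B) (a : A) :
    ∃ c, φ c = φ a ∧ ‖c‖ ≤ 2 * ‖φ a‖ := by
  obtain ⟨c, hc, hc'⟩ := φ.exists_norm_le_of_isSelfAdjoint (realPart a).2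
  obtain ⟨d, hd, hd'⟩ := φ.exists_norm_le_of_isSelfAdjoint (imaginaryPart a).2
  have hre : φ (realPart a) = realPart (φ a) := by
    simp [realPart_apply_coe, map_real_smul φ φ.continuous_of_cstarAlgebra,
      map_star φ a]
  have him : φ (imaginaryPart a) = imaginaryPart (φ a) := by
    simp [imaginaryPart_apply_coe, map_real_smul φ φ.continuous_of_cstarAlgebra,
      map_star φ a]
  refine ⟨c + Complex.I • d, ?_, ?_⟩
  · rw [map_add, map_smul, hc, hd, ← map_smul, ← map_add, realPart_add_I_smul_imaginaryPart]
  · rw [hre] at hc'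
    rw [him] at hd'
    have h₁ := hc'.trans (realPart.norm_le (φ a))
    have h₂ := hd'.trans (imaginaryPart.norm_le (φ a))
    calc ‖c + Complex.I • d‖ ≤ ‖c‖ + ‖Complex.I • d‖ := norm_add_le _ _
      _ = ‖c‖ + ‖d‖ := by simp [norm_smul]
      _ ≤ 2 * ‖φ a‖ := by linarith

/-- The range of a `⋆`-homomorphism between C⋆-algebras is closed. -/
theorem StarAlgHom.isClosed_range (φ : A →⋆ₐ[ℂ] B) : IsClosed (φ.range : Set B) := by
  let f : NormedAddGroupHom A B :=
    (φ : A →+ B).mkNormedAddGroupHom 1 fun a => by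
      simpa using NonUnitalStarAlgHom.norm_apply_le φ a
  -- Lifts with controlled norm and completeness of A let limits of range elements be lifted; 2
  -- counts real and imaginary parts.
  have hf : f.SurjectiveOnWith f.range 2 := by
    rintro _ ⟨a, rfl⟩
    exact φ.exists_norm_le a
  refine isClosed_of_closure_subset fun b hb => ?_
  obtain ⟨a, ha, -⟩ := controlled_closure_of_complete two_pos one_pos hf b hb
  exact ⟨a, ha⟩

end ClosedRange

/-! ### Generated C⋆-algebras and the homomorphism -/

section UnitalCStar

variable {A B : Type*} [CStarAlgebra A] [CStarAlgebra B] {r : ℕ}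

instance isClosed_unitalCStar (x : Fin r → A) : IsClosed (unitalCStar x : Set A) :=
  StarSubalgebra.isClosed_topologicalClosure _

theorem unitalCStar_le {x : Fin r → A} {S : StarSubalgebra ℂ A} (hS : IsClosed (S : Set A))
    (h : ∀ i, x i ∈ S) : unitalCStar x ≤ S :=
  StarSubalgebra.topologicalClosure_minimal
    (StarAlgebra.adjoin_le (Set.range_subset_iff.2 h)) hS

theorem unitalCStar_hom_surjective {x : Fin r → A} {y : Fin r → B}
    (φ : unitalCStar x →⋆ₐ[ℂ] unitalCStar y)
    (hφ : ∀ i, φ (unitalCStarGen x i) = unitalCStarGen y i) : Function.Surjective φ := by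
  have h : unitalCStar y ≤ ((unitalCStar y).subtype.comp φ).range :=
    unitalCStar_le (StarAlgHom.isClosed_range _) fun i => ⟨unitalCStarGen x i, by simp [hφ]; rfl⟩
  rintro ⟨b, hb⟩
  obtain ⟨a, ha⟩ := h hb
  exact ⟨a, Subtype.ext ha⟩

theorem unitalCStar_hom_ext {x : Fin r → A} {y : Fin r → B}
    {φ ψ : unitalCStar x →⋆ₐ[ℂ] unitalCStar y}
    (h : ∀ i, φ (unitalCStarGen x i) = ψ (unitalCStarGen x i)) : φ = ψ := by
  have hcl : IsClosed {a | φ a = ψ a} :=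
    isClosed_eq φ.continuous_of_cstarAlgebra ψ.continuous_of_cstarAlgebra
  have hle : unitalCStar x ≤ (StarAlgHom.equalizer φ ψ).map (unitalCStar x).subtype :=
    unitalCStar_le ((isClosed_unitalCStar x).isClosedEmbedding_subtypeVal.isClosedMap _ hcl)
      fun i => ⟨unitalCStarGen x i, h i, rfl⟩
  ext ⟨a, ha⟩
  obtain ⟨b, hb, rfl⟩ := hle ha
  exact congr_arg Subtype.val hb

/-- Self-adjoint generators need no adjoints added, so polynomials exhaust the ⋆-algebra. -/
theorem adjoin_toSubalgebra_eq_range_lift {x : Fin r → A} (hx : ∀ i, IsSelfAdjoint (x i)) :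
    (StarAlgebra.adjoin ℂ (Set.range x)).toSubalgebra = (FreeAlgebra.lift ℂ x).range := by
  have h : star (Set.range x) = Set.range x := by
    ext a
    simp only [Set.mem_star, Set.mem_range]
    exact exists_congr fun i => by rw [← star_inj, star_star, (hx i).star_eq]
  rw [StarAlgebra.adjoin_toSubalgebra, h, Set.union_self,
    Algebra.adjoin_range_eq_range_freeAlgebra_lift]

theorem norm_snd_le_norm_fst_of_mem {x : Fin r → A} {y : Fin r → B}
    (hx : ∀ i, IsSelfAdjoint (x i)) (hy : ∀ i, IsSelfAdjoint (y i))
    (h : ∀ p : FreeAlgebra ℂ (Fin r), ‖FreeAlgebra.lift ℂ y p‖ ≤ ‖FreeAlgebra.lift ℂ x p‖)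
    {c : A × B} (hc : c ∈ unitalCStar fun i => (x i, y i)) : ‖c.2‖ ≤ ‖c.1‖ := by
  have hcl : IsClosed {c : A × B | ‖c.2‖ ≤ ‖c.1‖} := isClosed_le (by fun_prop) (by fun_prop)
  refine closure_minimal (fun d hd => ?_) hcl hc
  have hd' : d ∈ (FreeAlgebra.lift ℂ fun i => (x i, y i)).range := by
    rw [← adjoin_toSubalgebra_eq_range_lift fun i => show star (x i, y i) = (x i, y i) from Prod.ext (hx i) (hy i)]
    exact hd
  obtain ⟨p, rfl⟩ := hd'
  have h₁ : (AlgHom.fst ℂ A B).comp (FreeAlgebra.lift ℂ fun i => (x i, y i)) =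
      FreeAlgebra.lift ℂ x := by
    ext
    simp
  have h₂ : (AlgHom.snd ℂ A B).comp (FreeAlgebra.lift ℂ fun i => (x i, y i)) =
      FreeAlgebra.lift ℂ y := by
    ext
    simp
  have := h p
  rw [← h₁, ← h₂] at this
  exact this

theorem exists_unitalCStar_hom_comp (f : A →⋆ₐ[ℂ] B) (x : Fin r → A) :
    ∃ φ : unitalCStar x →⋆ₐ[ℂ] unitalCStar (fun i => f (x i)),
      ∀ a, (φ a : B) = f a := by
  have h : unitalCStar x ≤ (unitalCStar fun i => f (x i)).comap f :=
    unitalCStar_le ((isClosed_unitalCStar _).preimage f.continuous_of_cstarAlgebra)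
      (mem_unitalCStar fun i => f (x i))
  exact ⟨(f.comp (unitalCStar x).subtype).codRestrict _ fun a => h a.2, fun a => rfl⟩

theorem exists_unitalCStar_hom {x : Fin r → A} {y : Fin r → B}
    (hx : ∀ i, IsSelfAdjoint (x i)) (hy : ∀ i, IsSelfAdjoint (y i))
    (h : ∀ p : FreeAlgebra ℂ (Fin r), ‖FreeAlgebra.lift ℂ y p‖ ≤ ‖FreeAlgebra.lift ℂ x p‖) :
    ∃ φ : unitalCStar x →⋆ₐ[ℂ] unitalCStar y,
      ∀ i, φ (unitalCStarGen x i) = unitalCStarGen y i := by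
  let z : Fin r → A × B := fun i => (x i, y i)
  obtain ⟨f, hf⟩ : ∃ φ : unitalCStar z →⋆ₐ[ℂ] unitalCStar x, ∀ a, (φ a : A) = (a : A × B).1 :=
    exists_unitalCStar_hom_comp (StarAlgHom.fst ℂ A B) z
  obtain ⟨g, hg⟩ : ∃ φ : unitalCStar z →⋆ₐ[ℂ] unitalCStar y, ∀ a, (φ a : B) = (a : A × B).2 :=
    exists_unitalCStar_hom_comp (StarAlgHom.snd ℂ A B) z
  have hfgen : ∀ i, f (unitalCStarGen z i) = unitalCStarGen x i := fun i => Subtype.ext (hf _)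
  have hggen : ∀ i, g (unitalCStarGen z i) = unitalCStarGen y i := fun i => Subtype.ext (hg _)
  -- If the first coordinate vanishes, the norm bound, extended to the closure, kills the second.
  have hinj : Function.Injective f := (injective_iff_map_eq_zero f).2 fun c hc => by
    have h₁ : (c : A × B).1 = 0 := by rw [← hf, hc]; rfl
    have h₂ := norm_snd_le_norm_fst_of_mem hx hy h c.2
    rw [h₁, norm_zero, norm_le_zero_iff] at h₂
    exact Subtype.ext (Prod.ext h₁ h₂)
  let e := StarAlgEquiv.ofBijective f ⟨hinj, unitalCStar_hom_surjective f hfgen⟩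
  refine ⟨g.comp (e.symm : unitalCStar x →⋆ₐ[ℂ] unitalCStar z), fun i => ?_⟩
  have he : e.symm (unitalCStarGen x i) = unitalCStarGen z i := by
    rw [← hfgen]
    exact e.symm_apply_apply _
  simp [he, hggen]

end UnitalCStar

theorem theorem2p2 {A B : Type*} [CStarAlgebra A] [CStarAlgebra B] {r : ℕ}
    (x : Fin r → A) (y : Fin r → B)
    (hx : ∀ i, IsSelfAdjoint (x i)) (hy : ∀ i, IsSelfAdjoint (y i))
    (h : (∀ (m : ℕ) (a₀ : Matrix (Fin m) (Fin m) ℂ) (a : Fin r → Matrix (Fin m) (Fin m) ℂ),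
            a₀.IsHermitian → (∀ i, (a i).IsHermitian) →
            spectrum ℂ (linearPencil a₀ a y) ⊆ spectrum ℂ (linearPencil a₀ a x)) ∨
         (∀ (m : ℕ) (a₀ : Matrix (Fin m) (Fin m) ℂ) (a : Fin r → Matrix (Fin m) (Fin m) ℂ),
            a₀.IsHermitian → (∀ i, (a i).IsHermitian) →
            HasGaussianRationalEntries a₀ → (∀ i, HasGaussianRationalEntries (a i)) →
            spectrum ℂ (linearPencil a₀ a y) ⊆ spectrum ℂ (linearPencil a₀ a x))) :
    (∃ φ : unitalCStar x →⋆ₐ[ℂ] unitalCStar y,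
      Function.Surjective φ ∧ (∀ i, φ (unitalCStarGen x i) = unitalCStarGen y i) ∧
      ∀ ψ : unitalCStar x →⋆ₐ[ℂ] unitalCStar y,
        (∀ i, ψ (unitalCStarGen x i) = unitalCStarGen y i) → ψ = φ) ∧
    ∀ p : FreeAlgebra ℂ (Fin r), ‖FreeAlgebra.lift ℂ y p‖ ≤ ‖FreeAlgebra.lift ℂ x p‖ := by
  have hnorm := norm_lift_le_of_spectrum_subset hx hy
    (h.elim id (spectrum_pencil_subset_of_gaussianRational hy))
  obtain ⟨φ, hφ⟩ := exists_unitalCStar_hom hx hy hnorm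
  exact ⟨⟨φ, unitalCStar_hom_surjective φ hφ, hφ,
    fun ψ hψ => unitalCStar_hom_ext fun i => (hψ i).trans (hφ i).symm⟩, hnorm⟩
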